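/- For real $q$ and $x>0$ put $\log_q x=\frac{x^{q-1}-1}{q-1}$ if $q\ne1$ and $\log_1 x=\log x$. Let $\exp_q$ be the inverse function, that is, $\exp_q x=(x(q-1)+1)^{1/(q-1)}$ for $x>-\frac1{q-1}$ if $q>1$ and for $x<-\frac1{q-1}$ if $q<1$, and $\exp_1 x=\exp x$ for all real $x$. Both functions are applied to Hermitian matrices by the functional calculus. Let $H$ be a complex $m\times n$ matrix that is a contraction (its operator norm with respect to the Euclidean norms is at most $1$), and for positive definite complex $m\times m$ matrices $A$ put $$\varphi(A)=\operatorname{Tr}\exp_q\bigl(H^*\log_q(A)H\bigr).$$ Then, for $0\le q\le 3$, $\varphi$ is well defined: the matrix $H^*\log_q(A)H$ is Hermitian, and its spectrum lies in the domain of $\exp_q$, for every positive definite $A$. Moreover: (i) $\varphi$ is concave on the positive definite matrices for $0\le q<1$; (ii) $\varphi$ is concave on the positive definite matrices for $1\le q\le 2$; (iii) $\varphi$ is convex on the positive definite matrices for $2<q\le 3$. -/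

import Mathlib

open scoped ComplexOrder Matrix

noncomputable section

/-- The deformed logarithm `log_q`, used for `x > 0`. -/
def logQ (q x : ℝ) : ℝ :=
  if q = 1 then Real.log x else (x ^ (q - 1) - 1) / (q - 1)

/-- The domain of `exp_q`: `x > -1/(q-1)` if `q > 1`, `x < -1/(q-1)` if `q < 1`,
and all of `ℝ` if `q = 1`. -/
def expQDomain (q : ℝ) : Set ℝ :=
  {x | (1 < q → -1 / (q - 1) < x) ∧ (q < 1 → x < -1 / (q - 1))}

/-- The deformed exponential `exp_q`, used for `x ∈ expQDomain q`. -/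
def expQ (q x : ℝ) : ℝ :=
  if q = 1 then Real.exp x else (x * (q - 1) + 1) ^ (1 / (q - 1))

section

open scoped Matrix.Norms.L2Operator

/-- `H` is a contraction: its operator norm, as a map between Euclidean spaces, is at most `1`. -/
def IsContraction {m n : Type*} [Fintype m] [Fintype n] [DecidableEq n]
    (H : Matrix m n ℂ) : Prop :=
  ‖H‖ ≤ 1

end

variable {m n : Type*} [Fintype m] [DecidableEq m] [Fintype n] [DecidableEq n]

/-- The matrix `H* log_q(A) H`, where `log_q(A)` is given by the functional calculus. -/
def compressedLogQ (q : ℝ) (H : Matrix m n ℂ) (A : Matrix m m ℂ) : Matrix n n ℂ :=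
  Hᴴ * cfc (logQ q) A * H

/-- The function `φ(A) = Tr exp_q(H* log_q(A) H)`. The trace of a Hermitian matrix is real, so
that taking the real part only changes the type. -/
def traceExpQ (q : ℝ) (H : Matrix m n ℂ) (A : Matrix m m ℂ) : ℝ :=
  (cfc (expQ q) (compressedLogQ q H A)).trace.re

end

/-! The proof is variational. The slope of `exp_q` at `log_q w` is `w ^ (2 - q)`, and `exp_q` is
convex for `q ≤ 2` and concave for `q ≥ 2`. So `Tr exp_q X` is the maximum (`q ≤ 2`) or minimum (`q
≥ 2`) over `W > 0` of `Tr W + Tr W^(2-q) (X - log_q W)`, attained at `W = exp_q X`.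

For `X = H* log_q(A) H`, choose `D` with `H*H + D*D = 1`. As `log_q 1 = 0`, the functional becomes
`Tr W` plus the quadratic forms of `relLogQ` at `H` for `(A, W)` and at `D` for `(1, W)`. Away from
`q = 1`, `relLogQ` is `(a^(q-1) w^(2-q) - w) / (q - 1)`. The theorems of Lieb and Ando make its form
jointly concave for `0 ≤ q ≤ 2` and jointly convex for `2 < q ≤ 3`; `q = 1` is a limit. Maximizing a
jointly concave function over `W` leaves a concave function of `A`, and minimizing a jointly convex
one leaves a convex function.

Lieb's and Ando's theorems follow from integral representations of powers, which reduce them to the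
kernel `a² / (α a + β w)` of `jointConvex_sq_div`. -/

namespace SpectralSum

open Matrix MeasureTheory Set Filter Topology

variable {m n : Type*} [Fintype m] [DecidableEq m] [Fintype n] [DecidableEq n]

/-! ### Quadratic forms of two-variable functional calculus -/

/-- The matrix `K`, written in the eigenbases of `A` and `W`. -/
noncomputable def coord {A : Matrix m m ℂ} {W : Matrix n n ℂ} (hA : A.IsHermitian)
    (hW : W.IsHermitian) (K : Matrix m n ℂ) : Matrix m n ℂ :=
  (hA.eigenvectorUnitary : Matrix m m ℂ)ᴴ * K * (hW.eigenvectorUnitary : Matrix n n ℂ)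

open scoped Classical in
/-- The quadratic form of `f(A ⊗ 1, 1 ⊗ W)` at `K`, that is, the sum of
`|⟨u i, K v j⟩|² f (a i) (w j)` over the eigenvectors and the eigenvalues of `A` and `W`. -/
noncomputable def spectralSum (f : ℝ → ℝ → ℝ) (K : Matrix m n ℂ) (A : Matrix m m ℂ)
    (W : Matrix n n ℂ) : ℝ :=
  if h : A.IsHermitian ∧ W.IsHermitian then
    ∑ i, ∑ j, ‖coord h.1 h.2 K i j‖ ^ 2 * f (h.1.eigenvalues i) (h.2.eigenvalues j)
  else 0

lemma spectralSum_eq (f : ℝ → ℝ → ℝ) (K : Matrix m n ℂ) {A : Matrix m m ℂ}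
    {W : Matrix n n ℂ} (hA : A.IsHermitian) (hW : W.IsHermitian) :
    spectralSum f K A W =
      ∑ i, ∑ j, ‖coord hA hW K i j‖ ^ 2 * f (hA.eigenvalues i) (hW.eigenvalues j) :=
  dif_pos ⟨hA, hW⟩

lemma conjTranspose_mul_self_eigenvectorUnitary {A : Matrix m m ℂ} (hA : A.IsHermitian) :
    (hA.eigenvectorUnitary : Matrix m m ℂ)ᴴ * (hA.eigenvectorUnitary : Matrix m m ℂ) = 1 :=
  Unitary.coe_star_mul_self hA.eigenvectorUnitary

lemma cfc_eq_conj {A : Matrix m m ℂ} (hA : A.IsHermitian) (g : ℝ → ℝ) :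
    cfc g A = (hA.eigenvectorUnitary : Matrix m m ℂ) *
      diagonal (fun i => (g (hA.eigenvalues i) : ℂ)) *
      (hA.eigenvectorUnitary : Matrix m m ℂ)ᴴ := by
  rw [hA.cfc_eq, IsHermitian.cfc, Unitary.conjStarAlgAut_apply]
  rfl

/-- Two different matrices `K` and `Z` are allowed for the sake of the cross term in
`jointConvex_sq_div`. -/
lemma trace_mul_cfc_mul_cfc (g h : ℝ → ℝ) (K Z : Matrix m n ℂ) {A : Matrix m m ℂ}
    {W : Matrix n n ℂ} (hA : A.IsHermitian) (hW : W.IsHermitian) :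
    (Kᴴ * cfc g A * Z * cfc h W).trace =
      ∑ i, ∑ j, star (coord hA hW K i j) * coord hA hW Z i j *
        ((g (hA.eigenvalues i) * h (hW.eigenvalues j) : ℝ) : ℂ) := by
  have key : (Kᴴ * cfc g A * Z * cfc h W).trace =
      ((coord hA hW K)ᴴ * diagonal (fun i => (g (hA.eigenvalues i) : ℂ)) *
        (coord hA hW Z * diagonal (fun j => (h (hW.eigenvalues j) : ℂ)))).trace := by
    rw [cfc_eq_conj hA, cfc_eq_conj hW]
    simp only [coord, conjTranspose_mul, conjTranspose_conjTranspose, ← Matrix.mul_assoc]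
    rw [Matrix.trace_mul_comm]
    simp only [Matrix.mul_assoc]
  rw [key, Matrix.trace, Finset.sum_comm]
  simp only [diag_apply]
  refine Finset.sum_congr rfl fun j _ => ?_
  rw [Matrix.mul_apply]
  simp only [mul_diagonal, conjTranspose_apply]
  refine Finset.sum_congr rfl fun i _ => ?_
  push_cast
  ring

lemma spectralSum_mul (g h : ℝ → ℝ) (K : Matrix m n ℂ) {A : Matrix m m ℂ}
    {W : Matrix n n ℂ} (hA : A.IsHermitian) (hW : W.IsHermitian) :
    spectralSum (fun a w => g a * h w) K A W = (Kᴴ * cfc g A * K * cfc h W).trace.re := by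
  rw [trace_mul_cfc_mul_cfc g h K K hA hW, spectralSum_eq _ _ hA hW, Complex.re_sum]
  refine Finset.sum_congr rfl fun i _ => ?_
  rw [Complex.re_sum]
  refine Finset.sum_congr rfl fun j _ => ?_
  rw [Complex.re_mul_ofReal, ← starRingEnd_apply, mul_comm (starRingEnd ℂ _), Complex.mul_conj,
    Complex.ofReal_re, Complex.normSq_eq_norm_sq]

lemma spectralSum_left (g : ℝ → ℝ) (K : Matrix m n ℂ) {A : Matrix m m ℂ}
    {W : Matrix n n ℂ} (hA : A.IsHermitian) (hW : W.IsHermitian) :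
    spectralSum (fun a _ => g a) K A W = (Kᴴ * cfc g A * K).trace.re := by
  have := spectralSum_mul g (fun _ => 1) K hA hW
  rwa [cfc_const_one ℝ W hW.isSelfAdjoint, Matrix.mul_one, show (fun a _ => g a * 1) =
    (fun (a : ℝ) (_ : ℝ) => g a) by ext; simp] at this

lemma spectralSum_right (h : ℝ → ℝ) (K : Matrix m n ℂ) {A : Matrix m m ℂ}
    {W : Matrix n n ℂ} (hA : A.IsHermitian) (hW : W.IsHermitian) :
    spectralSum (fun _ w => h w) K A W = (Kᴴ * K * cfc h W).trace.re := by
  have := spectralSum_mul (fun _ => 1) h K hA hW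
  rwa [cfc_const_one ℝ A hA.isSelfAdjoint, Matrix.mul_one, show (fun _ w => 1 * h w) =
    (fun (_ : ℝ) (w : ℝ) => h w) by ext; simp] at this

lemma spectralSum_swap (f : ℝ → ℝ → ℝ) (K : Matrix m n ℂ) (A : Matrix m m ℂ)
    (W : Matrix n n ℂ) :
    spectralSum (fun a w => f w a) K A W = spectralSum f Kᴴ W A := by
  by_cases h : A.IsHermitian ∧ W.IsHermitian
  · rw [spectralSum_eq _ _ h.1 h.2, spectralSum_eq _ _ h.2 h.1, Finset.sum_comm]
    refine Finset.sum_congr rfl fun j _ => Finset.sum_congr rfl fun i _ => ?_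
    have : coord h.2 h.1 Kᴴ = (coord h.1 h.2 K)ᴴ := by
      simp [coord, Matrix.mul_assoc]
    rw [this, conjTranspose_apply, norm_star]
  · rw [spectralSum, dif_neg h, spectralSum, dif_neg (fun h' => h ⟨h'.2, h'.1⟩)]

lemma spectralSum_add (f g : ℝ → ℝ → ℝ) (K : Matrix m n ℂ) (A : Matrix m m ℂ)
    (W : Matrix n n ℂ) :
    spectralSum (fun a w => f a w + g a w) K A W =
      spectralSum f K A W + spectralSum g K A W := by
  unfold spectralSum
  split_ifs
  · simp [mul_add, Finset.sum_add_distrib]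
  · simp

lemma spectralSum_const_mul (c : ℝ) (f : ℝ → ℝ → ℝ) (K : Matrix m n ℂ) (A : Matrix m m ℂ)
    (W : Matrix n n ℂ) :
    spectralSum (fun a w => c * f a w) K A W = c * spectralSum f K A W := by
  unfold spectralSum
  split_ifs
  · simp [Finset.mul_sum, mul_left_comm]
  · simp

lemma spectralSum_sub (f g : ℝ → ℝ → ℝ) (K : Matrix m n ℂ) (A : Matrix m m ℂ)
    (W : Matrix n n ℂ) :
    spectralSum (fun a w => f a w - g a w) K A W =
      spectralSum f K A W - spectralSum g K A W := by
  unfold spectralSum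
  split_ifs
  · simp [mul_sub, Finset.sum_sub_distrib]
  · simp

lemma spectralSum_congr {f g : ℝ → ℝ → ℝ} (h : ∀ a w, 0 < a → 0 < w → f a w = g a w)
    (K : Matrix m n ℂ) {A : Matrix m m ℂ} {W : Matrix n n ℂ} (hA : A.PosDef) (hW : W.PosDef) :
    spectralSum f K A W = spectralSum g K A W := by
  rw [spectralSum_eq _ _ hA.1 hW.1, spectralSum_eq _ _ hA.1 hW.1]
  exact Finset.sum_congr rfl fun i _ => Finset.sum_congr rfl fun j _ => by
    rw [h _ _ (hA.eigenvalues_pos i) (hW.eigenvalues_pos j)]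

lemma spectralSum_nonneg {f : ℝ → ℝ → ℝ} (K : Matrix m n ℂ) {A : Matrix m m ℂ}
    {W : Matrix n n ℂ} (hA : A.IsHermitian) (hW : W.IsHermitian)
    (h : ∀ i j, 0 ≤ f (hA.eigenvalues i) (hW.eigenvalues j)) : 0 ≤ spectralSum f K A W := by
  rw [spectralSum_eq _ _ hA hW]
  exact Finset.sum_nonneg fun i _ => Finset.sum_nonneg fun j _ =>
    mul_nonneg (sq_nonneg _) (h i j)

/-! ### Joint convexity -/

/-- The pairs of positive definite matrices. -/
def posDefPairs (m n : Type*) [Fintype m] [Fintype n] :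
    Set (Matrix m m ℂ × Matrix n n ℂ) :=
  {P | P.1.PosDef ∧ P.2.PosDef}

omit [Fintype m] [DecidableEq m] in
lemma posDef_combo {A B : Matrix m m ℂ} (hA : A.PosDef) (hB : B.PosDef) {a b : ℝ}
    (ha : 0 ≤ a) (hb : 0 ≤ b) (hab : a + b = 1) : (a • A + b • B).PosDef := by
  rcases ha.eq_or_lt with rfl | ha
  · obtain rfl : b = 1 := by linarith
    simpa using hB
  · rcases hb.eq_or_lt with rfl | hb
    · obtain rfl : a = 1 := by linarith
      simpa using hA
    · exact (hA.smul ha).add (hB.smul hb)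

omit [Fintype m] [DecidableEq m] in
lemma convex_posDef : Convex ℝ {A : Matrix m m ℂ | A.PosDef} :=
  fun _ hA _ hB _ _ ha hb hab => posDef_combo hA hB ha hb hab

omit [DecidableEq m] [DecidableEq n] in
lemma convex_posDefPairs : Convex ℝ (posDefPairs m n) :=
  fun _ hA _ hB _ _ ha hb hab =>
    ⟨posDef_combo hA.1 hB.1 ha hb hab, posDef_combo hA.2 hB.2 ha hb hab⟩

/-- `f(A ⊗ 1, 1 ⊗ W)` has a jointly convex quadratic form at `K`. -/
def JointConvex (f : ℝ → ℝ → ℝ) (K : Matrix m n ℂ) : Prop :=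
  ConvexOn ℝ (posDefPairs m n) fun P => spectralSum f K P.1 P.2

lemma JointConvex.congr {f g : ℝ → ℝ → ℝ} {K : Matrix m n ℂ} (hf : JointConvex f K)
    (h : ∀ a w, 0 < a → 0 < w → f a w = g a w) : JointConvex g K :=
  ConvexOn.congr hf fun _ hP => spectralSum_congr h K hP.1 hP.2

lemma JointConvex.swap {f : ℝ → ℝ → ℝ} {K : Matrix m n ℂ} (hf : JointConvex f Kᴴ) :
    JointConvex (fun a w => f w a) K := by
  refine ⟨convex_posDefPairs, fun P hP Q hQ a b ha hb hab => ?_⟩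
  simp only [spectralSum_swap]
  exact hf.2 (x := P.swap) ⟨hP.2, hP.1⟩ (y := Q.swap) ⟨hQ.2, hQ.1⟩ ha hb hab

lemma JointConvex.add {f g : ℝ → ℝ → ℝ} {K : Matrix m n ℂ} (hf : JointConvex f K)
    (hg : JointConvex g K) : JointConvex (fun a w => f a w + g a w) K := by
  refine ⟨convex_posDefPairs, fun P hP Q hQ a b ha hb hab => ?_⟩
  have h1 := hf.2 hP hQ ha hb hab
  have h2 := hg.2 hP hQ ha hb hab
  simp only [spectralSum_add, smul_eq_mul] at h1 h2 ⊢
  linarith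

lemma JointConvex.const_mul {f : ℝ → ℝ → ℝ} {K : Matrix m n ℂ} (hf : JointConvex f K) {c : ℝ}
    (hc : 0 ≤ c) : JointConvex (fun a w => c * f a w) K := by
  refine ⟨convex_posDefPairs, fun P hP Q hQ a b ha hb hab => ?_⟩
  have h1 := mul_le_mul_of_nonneg_left (hf.2 hP hQ ha hb hab) hc
  simp only [spectralSum_const_mul, smul_eq_mul] at h1 ⊢
  linarith

lemma jointConvex_fst (c : ℝ) (K : Matrix m n ℂ) : JointConvex (fun a _ => c * a) K := by
  refine ⟨convex_posDefPairs, fun P hP Q hQ a b ha hb hab => le_of_eq ?_⟩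
  have key : ∀ R ∈ posDefPairs m n,
      spectralSum (fun a _ => c * a) K R.1 R.2 = c * (Kᴴ * R.1 * K).trace.re := fun R hR => by
    rw [spectralSum_const_mul c (fun a _ => a), spectralSum_left _ K hR.1.1 hR.2.1,
      cfc_id' ℝ R.1 hR.1.1.isSelfAdjoint]
  simp only [key _ hP, key _ hQ, key _ (convex_posDefPairs hP hQ ha hb hab)]
  simp [Matrix.mul_add, Matrix.add_mul]
  ring

lemma jointConvex_snd (c : ℝ) (K : Matrix m n ℂ) : JointConvex (fun _ w => c * w) K :=
  (jointConvex_fst c Kᴴ).swap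

/-- Joint convexity of `a² / (α a + β w)`, as a supremum of affine functions. -/
lemma jointConvex_sq_div {α β : ℝ} (hα : 0 ≤ α) (hβ : 0 ≤ β) (hαβ : 0 < α + β)
    (K : Matrix m n ℂ) : JointConvex (fun a w => a ^ 2 / (α * a + β * w)) K := by
  -- For fixed `Z` this is real linear in `P`. In eigenbases it is a concave quadratic in each entry
  -- of `Z`, to be maximized by completing the square.
  let L : Matrix m n ℂ → Matrix m m ℂ × Matrix n n ℂ → ℝ := fun Z P =>
    2 * (Kᴴ * P.1 * Z).trace.re - α * (Zᴴ * P.1 * Z).trace.re - β * (Zᴴ * Z * P.2).trace.re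
  have hL : ∀ Z, ∀ P (hP : P ∈ posDefPairs m n), L Z P = ∑ i, ∑ j,
      (2 * hP.1.1.eigenvalues i *
          (star (coord hP.1.1 hP.2.1 K i j) * coord hP.1.1 hP.2.1 Z i j).re
        - (α * hP.1.1.eigenvalues i + β * hP.2.1.eigenvalues j) *
          ‖coord hP.1.1 hP.2.1 Z i j‖ ^ 2) := by
    intro Z P hP
    have h1 := trace_mul_cfc_mul_cfc (fun a => a) (fun _ => 1) K Z hP.1.1 hP.2.1
    rw [cfc_id' ℝ P.1 hP.1.1.isSelfAdjoint, cfc_const_one ℝ P.2 hP.2.1.isSelfAdjoint,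
      Matrix.mul_one] at h1
    have h2 := spectralSum_left (fun a => a) Z hP.1.1 hP.2.1
    rw [cfc_id' ℝ P.1 hP.1.1.isSelfAdjoint, spectralSum_eq _ _ hP.1.1 hP.2.1] at h2
    have h3 := spectralSum_right (fun a => a) Z hP.1.1 hP.2.1
    rw [cfc_id' ℝ P.2 hP.2.1.isSelfAdjoint, spectralSum_eq _ _ hP.1.1 hP.2.1] at h3
    simp only [L]
    rw [h1, ← h2, ← h3]
    simp only [Complex.re_sum, Complex.re_mul_ofReal, Finset.mul_sum, ← Finset.sum_sub_distrib]
    refine Finset.sum_congr rfl fun i _ => Finset.sum_congr rfl fun j _ => ?_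
    ring
  have hpos : ∀ {a w : ℝ}, 0 < a → 0 < w → 0 < α * a + β * w := fun {a w} ha hw => by
    rcases hα.eq_or_lt with rfl | hα'
    · have : 0 < β := by linarith
      positivity
    · positivity
  have hle : ∀ Z, ∀ P ∈ posDefPairs m n,
      L Z P ≤ spectralSum (fun a w => a ^ 2 / (α * a + β * w)) K P.1 P.2 := by
    intro Z P hP
    rw [hL Z P hP, spectralSum_eq _ _ hP.1.1 hP.2.1]
    refine Finset.sum_le_sum fun i _ => Finset.sum_le_sum fun j _ => ?_
    have ha := hP.1.eigenvalues_pos i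
    have hd := hpos ha (hP.2.eigenvalues_pos j)
    set a := hP.1.1.eigenvalues i
    set d := α * a + β * hP.2.1.eigenvalues j
    set k := coord hP.1.1 hP.2.1 K i j
    set z := coord hP.1.1 hP.2.1 Z i j
    have h1 : (star k * z).re ≤ ‖k‖ * ‖z‖ := by
      simpa using Complex.re_le_norm (star k * z)
    have h2 : 2 * a * (star k * z).re ≤ 2 * a * (‖k‖ * ‖z‖) := by gcongr
    have h3 : ‖k‖ ^ 2 * (a ^ 2 / d) - (2 * a * (‖k‖ * ‖z‖) - d * ‖z‖ ^ 2) =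
        (a * ‖k‖ - d * ‖z‖) ^ 2 / d := by
      field_simp
      ring
    have h4 : 0 ≤ (a * ‖k‖ - d * ‖z‖) ^ 2 / d := by positivity
    linarith
  have heq : ∀ P ∈ posDefPairs m n, ∃ Z,
      L Z P = spectralSum (fun a w => a ^ 2 / (α * a + β * w)) K P.1 P.2 := by
    intro P hP
    -- The entrywise maximizer `z = a k / (α a + β w)`, then carried back from the eigenbases.
    let z : Matrix m n ℂ := fun i j => ((hP.1.1.eigenvalues i /
      (α * hP.1.1.eigenvalues i + β * hP.2.1.eigenvalues j) : ℝ) : ℂ) *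
        coord hP.1.1 hP.2.1 K i j
    refine ⟨(hP.1.1.eigenvectorUnitary : Matrix m m ℂ) * z *
      (hP.2.1.eigenvectorUnitary : Matrix n n ℂ)ᴴ, ?_⟩
    rw [hL _ P hP, spectralSum_eq _ _ hP.1.1 hP.2.1]
    have hz : coord hP.1.1 hP.2.1 ((hP.1.1.eigenvectorUnitary : Matrix m m ℂ) * z *
        (hP.2.1.eigenvectorUnitary : Matrix n n ℂ)ᴴ) = z := by
      simp only [coord, Matrix.mul_assoc, conjTranspose_mul_self_eigenvectorUnitary hP.2.1,
        Matrix.mul_one]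
      rw [← Matrix.mul_assoc, conjTranspose_mul_self_eigenvectorUnitary hP.1.1, Matrix.one_mul]
    rw [hz]
    refine Finset.sum_congr rfl fun i _ => Finset.sum_congr rfl fun j _ => ?_
    have ha := hP.1.eigenvalues_pos i
    have hd := hpos ha (hP.2.eigenvalues_pos j)
    simp only [z]
    set a := hP.1.1.eigenvalues i
    set d := α * a + β * hP.2.1.eigenvalues j
    set k := coord hP.1.1 hP.2.1 K i j
    have h1 : (star k * (((a / d : ℝ) : ℂ) * k)).re = a / d * ‖k‖ ^ 2 := by
      rw [mul_left_comm, Complex.re_ofReal_mul, ← starRingEnd_apply, mul_comm (starRingEnd ℂ _),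
        Complex.mul_conj, Complex.ofReal_re, Complex.normSq_eq_norm_sq]
    rw [h1, norm_mul, Complex.norm_real, mul_pow, Real.norm_eq_abs, sq_abs]
    field_simp
    ring
  refine ⟨convex_posDefPairs, fun P hP Q hQ a b ha hb hab => ?_⟩
  obtain ⟨Z, hZ⟩ := heq _ (convex_posDefPairs hP hQ ha hb hab)
  beta_reduce
  rw [← hZ]
  have hlin : L Z (a • P + b • Q) = a * L Z P + b * L Z Q := by
    simp [L, Matrix.mul_add, Matrix.add_mul]
    ring
  rw [hlin]
  exact add_le_add (mul_le_mul_of_nonneg_left (hle Z P hP) ha)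
    (mul_le_mul_of_nonneg_left (hle Z Q hQ) hb)

/-! ### Integrals and pointwise limits -/

lemma integral_spectralSum {μ : Measure ℝ} {f : ℝ → ℝ → ℝ → ℝ} (K : Matrix m n ℂ)
    {A : Matrix m m ℂ} {W : Matrix n n ℂ} (hA : A.PosDef) (hW : W.PosDef)
    (hf : ∀ a w, 0 < a → 0 < w → Integrable (fun t => f t a w) μ) :
    Integrable (fun t => spectralSum (f t) K A W) μ ∧
      ∫ t, spectralSum (f t) K A W ∂μ = spectralSum (fun a w => ∫ t, f t a w ∂μ) K A W := by
  have hi : ∀ i j, Integrable (fun t => ‖coord hA.1 hW.1 K i j‖ ^ 2 *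
      f t (hA.1.eigenvalues i) (hW.1.eigenvalues j)) μ := fun i j =>
    (hf _ _ (hA.eigenvalues_pos i) (hW.eigenvalues_pos j)).const_mul _
  simp only [spectralSum_eq _ _ hA.1 hW.1]
  refine ⟨integrable_finsetSum _ fun i _ => integrable_finsetSum _ fun j _ => hi i j, ?_⟩
  rw [integral_finsetSum _ fun i _ => integrable_finsetSum _ fun j _ => hi i j]
  refine Finset.sum_congr rfl fun i _ => ?_
  rw [integral_finsetSum _ fun j _ => hi i j]
  simp only [integral_const_mul]

lemma JointConvex.integral {μ : Measure ℝ} {f : ℝ → ℝ → ℝ → ℝ} {K : Matrix m n ℂ}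
    (hf : ∀ a w, 0 < a → 0 < w → Integrable (fun t => f t a w) μ)
    (hc : ∀ᵐ t ∂μ, JointConvex (f t) K) :
    JointConvex (fun a w => ∫ t, f t a w ∂μ) K := by
  refine ⟨convex_posDefPairs, fun P hP Q hQ a b ha hb hab => ?_⟩
  have hR := convex_posDefPairs hP hQ ha hb hab
  have h1 := integral_spectralSum K hP.1 hP.2 hf
  have h2 := integral_spectralSum K hQ.1 hQ.2 hf
  have h3 := integral_spectralSum K hR.1 hR.2 hf
  beta_reduce
  rw [← h1.2, ← h2.2, ← h3.2, smul_eq_mul, smul_eq_mul, ← integral_const_mul,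
    ← integral_const_mul, ← integral_add (h1.1.const_mul _) (h2.1.const_mul _)]
  refine integral_mono_ae h3.1 ((h1.1.const_mul _).add (h2.1.const_mul _)) ?_
  filter_upwards [hc] with t ht
  exact ht.2 hP hQ ha hb hab

lemma JointConvex.of_tendsto {ι : Type*} {l : Filter ι} [l.NeBot] {f : ι → ℝ → ℝ → ℝ}
    {g : ℝ → ℝ → ℝ} {K : Matrix m n ℂ}
    (hf : ∀ a w, 0 < a → 0 < w → Tendsto (fun t => f t a w) l (𝓝 (g a w)))
    (hc : ∀ᶠ t in l, JointConvex (f t) K) : JointConvex g K := by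
  have key : ∀ P ∈ posDefPairs m n,
      Tendsto (fun t => spectralSum (f t) K P.1 P.2) l (𝓝 (spectralSum g K P.1 P.2)) := by
    intro P hP
    simp only [spectralSum_eq _ _ hP.1.1 hP.2.1]
    exact tendsto_finsetSum _ fun i _ => tendsto_finsetSum _ fun j _ =>
      (hf _ _ (hP.1.eigenvalues_pos i) (hP.2.eigenvalues_pos j)).const_mul _
  refine ⟨convex_posDefPairs, fun P hP Q hQ a b ha hb hab => ?_⟩
  refine le_of_tendsto_of_tendsto (key _ (convex_posDefPairs hP hQ ha hb hab))
    (((key P hP).const_mul a).add ((key Q hQ).const_mul b)) ?_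
  filter_upwards [hc] with t ht
  exact ht.2 hP hQ ha hb hab

/-! ### The theorems of Lieb and Ando -/

/-- Lieb's concavity theorem, for the powers `p` and `1 - p`. -/
lemma jointConvex_neg_rpow {p : ℝ} (hp : p ∈ Ioo 0 1) (K : Matrix m n ℂ) :
    JointConvex (fun a w => -(a ^ p * w ^ (1 - p))) K := by
  obtain ⟨μ, hμ⟩ := Real.exists_measure_rpow_eq_integral_rpowIntegrand₀₁ hp
  have hi : ∀ a w : ℝ, 0 < a → 0 < w →
      Integrable (fun t => -w * Real.rpowIntegrand₀₁ p t (a / w)) (μ.restrict (Ioi 0)) :=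
    fun a w ha hw => (hμ (a / w) (div_pos ha hw).le).1.const_mul _
  refine (JointConvex.integral (K := K) hi ?_).congr fun a w ha hw => ?_
  · filter_upwards [ae_restrict_mem measurableSet_Ioi] with t ht
    have ht : 0 < t := ht
    -- The integrand equals `-t^(p-1) w + t^p w² / (t w + a)`.
    refine ((jointConvex_snd (-(t ^ p * t⁻¹)) K).add ((JointConvex.swap
      (jointConvex_sq_div ht.le zero_le_one (by positivity) Kᴴ)).const_mul
        (Real.rpow_nonneg ht.le p))).congr fun a w ha hw => ?_
    simp only [Real.rpowIntegrand₀₁]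
    field_simp
    ring
  · rw [integral_const_mul, ← (hμ (a / w) (div_pos ha hw).le).2, Real.div_rpow ha.le hw.le,
      Real.rpow_sub hw, Real.rpow_one]
    field_simp

/-- Ando's convexity theorem, for the powers `p` and `1 - p`. -/
lemma jointConvex_rpow {p : ℝ} (hp : p ∈ Ioc 1 2) (K : Matrix m n ℂ) :
    JointConvex (fun a w => a ^ p * w ^ (1 - p)) K := by
  rcases hp.2.eq_or_lt with rfl | hp2
  -- At `p = 2` the exponent `p - 1` leaves the range of the integral representation, but the
  -- function is the kernel `a² / w` itself.
  · refine (jointConvex_sq_div le_rfl zero_le_one (by norm_num) K).congr fun a w ha hw => ?_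
    rw [Real.rpow_two, show (1 - 2 : ℝ) = -1 by norm_num, Real.rpow_neg_one]
    simp [div_eq_mul_inv]
  obtain ⟨μ, hμ⟩ := Real.exists_measure_rpow_eq_integral_rpowIntegrand₀₁ (p := p - 1)
    ⟨by linarith [hp.1], by linarith⟩
  have hi : ∀ a w : ℝ, 0 < a → 0 < w →
      Integrable (fun t => a * Real.rpowIntegrand₀₁ (p - 1) t (a / w)) (μ.restrict (Ioi 0)) :=
    fun a w ha hw => (hμ (a / w) (div_pos ha hw).le).1.const_mul _
  refine (JointConvex.integral (K := K) hi ?_).congr fun a w ha hw => ?_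
  · filter_upwards [ae_restrict_mem measurableSet_Ioi] with t ht
    have ht : 0 < t := ht
    -- The integrand equals `t^(p-2) a² / (a + t w)`.
    refine ((jointConvex_sq_div zero_le_one ht.le (by positivity) K).const_mul
      (c := t ^ (p - 1) * t⁻¹) (by positivity)).congr fun a w ha hw => ?_
    simp only [Real.rpowIntegrand₀₁]
    field_simp
    ring
  · rw [integral_const_mul, ← (hμ (a / w) (div_pos ha hw).le).2, Real.div_rpow ha.le hw.le,
      ← neg_sub p 1, Real.rpow_neg hw.le, Real.rpow_sub ha, Real.rpow_one]
    field_simp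

/-! ### The kernel `relLogQ` -/

/-- The slope of the tangent to `exp_q` at `log_q w` times `log_q a - log_q w`. -/
noncomputable def relLogQ (q a w : ℝ) : ℝ := w ^ (2 - q) * (logQ q a - logQ q w)

lemma relLogQ_eq {q a w : ℝ} (hq : q ≠ 1) (hw : 0 < w) :
    relLogQ q a w = (a ^ (q - 1) * w ^ (1 - (q - 1)) - w) / (q - 1) := by
  have hq' : q - 1 ≠ 0 := sub_ne_zero.2 hq
  have h : w ^ (2 - q) * w ^ (q - 1) = w := by
    rw [← Real.rpow_add hw, show 2 - q + (q - 1) = 1 by ring, Real.rpow_one]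
  rw [relLogQ, logQ, logQ, if_neg hq, if_neg hq, show 1 - (q - 1) = 2 - q by ring]
  field_simp
  linear_combination -h

/-- The quotient defining `log_q x` is the slope at `1` of `q ↦ x ^ (q - 1)`, whose derivative there
is `log x`. -/
lemma tendsto_logQ {x : ℝ} (hx : 0 < x) : Tendsto (fun q => logQ q x) (𝓝[>] 1) (𝓝 (logQ 1 x)) := by
  have h : HasDerivAt (fun q : ℝ => x ^ (q - 1)) (Real.log x) 1 := by
    have := ((hasDerivAt_id (1 : ℝ)).sub_const 1).const_rpow hx
    simpa using this
  have h2 := (hasDerivAt_iff_tendsto_slope.1 h).mono_left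
    (nhdsWithin_mono 1 (fun q (hq : 1 < q) => hq.ne'))
  rw [logQ, if_pos rfl]
  refine h2.congr' ?_
  filter_upwards [self_mem_nhdsWithin] with q hq
  rw [logQ, if_neg (ne_of_gt hq), slope_def_field]
  simp

lemma jointConvex_relLogQ {q : ℝ} (h2 : 2 < q) (h3 : q ≤ 3) (K : Matrix m n ℂ) :
    JointConvex (relLogQ q) K := by
  refine (((jointConvex_rpow (p := q - 1) ⟨by linarith, by linarith⟩ K).add
    (jointConvex_snd (-1) K)).const_mul (c := (q - 1)⁻¹)
      (inv_nonneg.2 (by linarith))).congr fun a w ha hw => ?_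
  rw [relLogQ_eq (by linarith) hw]
  ring

lemma jointConvex_neg_relLogQ {q : ℝ} (h0 : 0 ≤ q) (h2 : q ≤ 2) (K : Matrix m n ℂ) :
    JointConvex (fun a w => -relLogQ q a w) K := by
  have key : ∀ q : ℝ, 1 < q → q < 2 → ∀ K : Matrix m n ℂ,
      JointConvex (fun a w => -relLogQ q a w) K := by
    intro q h1 h2 K
    refine (((jointConvex_neg_rpow (p := q - 1) ⟨by linarith, by linarith⟩ K).add
      (jointConvex_snd 1 K)).const_mul (c := (q - 1)⁻¹)
        (inv_nonneg.2 (by linarith))).congr fun a w ha hw => ?_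
    rw [relLogQ_eq (by linarith) hw]
    ring
  rcases h2.eq_or_lt with rfl | h2
  · refine ((jointConvex_fst (-1) K).add (jointConvex_snd 1 K)).congr fun a w ha hw => ?_
    rw [relLogQ_eq (by norm_num) hw]
    norm_num
    ring
  rcases lt_trichotomy q 1 with h1 | rfl | h1
  -- For `q < 1`, Ando's theorem applies with the roles of `a` and `w` exchanged: the exponent `2 -
  -- q` of `w` lies in `(1, 2]`.
  · refine (((jointConvex_rpow (p := 1 - (q - 1)) ⟨by linarith, by linarith⟩ Kᴴ).swap.add
      (jointConvex_snd (-1) K)).const_mul (c := (1 - q)⁻¹)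
        (inv_nonneg.2 (by linarith))).congr fun a w ha hw => ?_
    rw [relLogQ_eq (by linarith) hw, sub_sub_cancel, ← neg_sub q 1, inv_neg]
    ring
  · refine JointConvex.of_tendsto (l := 𝓝[>] (1 : ℝ)) (f := fun q a w => -relLogQ q a w)
      (fun a w ha hw => ?_) ?_
    · refine Tendsto.neg (Tendsto.mul ?_ ((tendsto_logQ ha).sub (tendsto_logQ hw)))
      refine Tendsto.mono_left ?_ nhdsWithin_le_nhds
      have : Continuous fun q : ℝ => w ^ (2 - q) :=
        (Real.continuous_const_rpow hw.ne').comp (by fun_prop)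
      exact this.tendsto 1
    · filter_upwards [Ioo_mem_nhdsGT (show (1 : ℝ) < 2 by norm_num)] with q hq
      exact key q hq.1 hq.2 K
  · exact key q h1 h2 K

/-! ### Scalar tangent inequalities for `exp_q` -/

lemma expQ_pos {q x : ℝ} (hx : x ∈ expQDomain q) : 0 < expQ q x := by
  unfold expQ
  split_ifs with h
  · exact Real.exp_pos x
  · apply Real.rpow_pos_of_pos
    rcases lt_or_gt_of_ne h with h | h
    · have := hx.2 h
      rw [lt_div_iff_of_neg (by linarith)] at this
      linarith
    · have := hx.1 h
      rw [div_lt_iff₀ (by linarith)] at this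
      linarith

lemma logQ_expQ {q x : ℝ} (hx : x ∈ expQDomain q) : logQ q (expQ q x) = x := by
  unfold expQ logQ
  split_ifs with h
  · exact Real.log_exp x
  · have hq : q - 1 ≠ 0 := sub_ne_zero.2 h
    have : 0 ≤ x * (q - 1) + 1 := by
      rcases lt_or_gt_of_ne h with h | h
      · have := hx.2 h
        rw [lt_div_iff_of_neg (by linarith)] at this
        linarith
      · have := hx.1 h
        rw [div_lt_iff₀ (by linarith)] at this
        linarith
    rw [← Real.rpow_mul this, one_div_mul_cancel hq, Real.rpow_one]
    field_simp
    ring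

lemma logQ_mem_expQDomain {q x : ℝ} (hx : 0 < x) : logQ q x ∈ expQDomain q := by
  have hp := Real.rpow_pos_of_pos hx (q - 1)
  refine ⟨fun h => ?_, fun h => ?_⟩
  · rw [logQ, if_neg h.ne', div_lt_div_iff_of_pos_right (by linarith)]
    linarith
  · rw [logQ, if_neg h.ne, div_lt_div_right_of_neg (by linarith)]
    linarith

/-- Homogeneity of degree one reduces the tangent inequalities to the tangent of `log_q` at `1`. -/
lemma relLogQ_eq_mul_logQ_div {q a w : ℝ} (ha : 0 < a) (hw : 0 < w) :
    relLogQ q a w = w * logQ q (a / w) := by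
  by_cases hq : q = 1
  · subst hq
    rw [relLogQ, logQ, logQ, logQ, if_pos rfl, if_pos rfl, if_pos rfl,
      Real.log_div ha.ne' hw.ne', show (2 - 1 : ℝ) = 1 by norm_num, Real.rpow_one]
  · have hq' : q - 1 ≠ 0 := sub_ne_zero.2 hq
    rw [relLogQ_eq hq hw, logQ, if_neg hq, Real.div_rpow ha.le hw.le, Real.rpow_sub hw,
      Real.rpow_one]
    field_simp

lemma logQ_le_sub_one {q t : ℝ} (hq : q ≤ 2) (ht : 0 < t) : logQ q t ≤ t - 1 := by
  rcases lt_trichotomy q 1 with h1 | rfl | h1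
  · rw [logQ, if_neg h1.ne, div_le_iff_of_neg (by linarith), Real.rpow_def_of_pos ht]
    have h2 := Real.add_one_le_exp (Real.log t * (q - 1))
    nlinarith [Real.log_le_sub_one_of_pos ht]
  · rw [logQ, if_pos rfl]
    exact Real.log_le_sub_one_of_pos ht
  · rw [logQ, if_neg h1.ne', div_le_iff₀ (by linarith)]
    have := rpow_one_add_le_one_add_mul_self (s := t - 1) (by linarith) (p := q - 1)
      (by linarith) (by linarith)
    rw [add_sub_cancel] at this
    linarith

lemma sub_one_le_logQ {q t : ℝ} (hq : 2 ≤ q) (ht : 0 < t) : t - 1 ≤ logQ q t := by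
  rw [logQ, if_neg (by linarith), le_div_iff₀ (by linarith)]
  have := one_add_mul_self_le_rpow_one_add (s := t - 1) (by linarith) (p := q - 1) (by linarith)
  rw [add_sub_cancel] at this
  linarith

lemma relLogQ_le {q a w : ℝ} (hq : q ≤ 2) (ha : 0 < a) (hw : 0 < w) :
    w + relLogQ q a w ≤ a := by
  have := mul_le_mul_of_nonneg_left (logQ_le_sub_one hq (div_pos ha hw)) hw.le
  rw [relLogQ_eq_mul_logQ_div ha hw]
  rw [mul_sub, mul_div_cancel₀ _ hw.ne'] at this
  linarith

lemma le_relLogQ {q a w : ℝ} (hq : 2 ≤ q) (ha : 0 < a) (hw : 0 < w) :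
    a ≤ w + relLogQ q a w := by
  have := mul_le_mul_of_nonneg_left (sub_one_le_logQ hq (div_pos ha hw)) hw.le
  rw [relLogQ_eq_mul_logQ_div ha hw]
  rw [mul_sub, mul_div_cancel₀ _ hw.ne'] at this
  linarith

/-- This is `relLogQ_le` at `a = exp_q x`. -/
lemma tangent_expQ_le {q x w : ℝ} (hq : q ≤ 2) (hx : x ∈ expQDomain q) (hw : 0 < w) :
    w + w ^ (2 - q) * (x - logQ q w) ≤ expQ q x := by
  have := relLogQ_le hq (expQ_pos hx) hw
  rwa [relLogQ, logQ_expQ hx] at this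

lemma expQ_le_tangent {q x w : ℝ} (hq : 2 ≤ q) (hx : x ∈ expQDomain q) (hw : 0 < w) :
    expQ q x ≤ w + w ^ (2 - q) * (x - logQ q w) := by
  have := le_relLogQ hq (expQ_pos hx) hw
  rwa [relLogQ, logQ_expQ hx] at this

/-! ### Contractions and the spectrum of the compression -/

section

open scoped Matrix.Norms.L2Operator MatrixOrder

omit [DecidableEq m] in
lemma exists_conjTranspose_mul_self_add_eq_one {H : Matrix m n ℂ} (hH : IsContraction H) :
    ∃ D : Matrix n n ℂ, Hᴴ * H + Dᴴ * D = 1 := by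
  have h1 : ‖Hᴴ * H‖ ≤ 1 := by
    rw [Matrix.l2_opNorm_conjTranspose_mul_self]
    exact mul_le_one₀ hH (norm_nonneg _) hH
  have h2 : Hᴴ * H ≤ 1 :=
    (CStarAlgebra.norm_le_one_iff_of_nonneg _ (posSemidef_conjTranspose_mul_self H).nonneg).1 h1
  obtain ⟨D, hD⟩ := CStarAlgebra.nonneg_iff_eq_star_mul_self.1 (sub_nonneg.2 h2)
  exact ⟨D, by rw [← star_eq_conjTranspose D, ← hD, add_sub_cancel]⟩

end

omit [Fintype n] [DecidableEq n] in
lemma isHermitian_compressedLogQ (q : ℝ) (H : Matrix m n ℂ) (A : Matrix m m ℂ) :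
    (compressedLogQ q H A).IsHermitian :=
  isHermitian_conjTranspose_mul_mul H (cfc_predicate (logQ q) A : IsSelfAdjoint _)

lemma convex_expQDomain (q : ℝ) : Convex ℝ (expQDomain q) :=
  Set.OrdConnected.convex ⟨fun _ hx _ hy _ hz =>
    ⟨fun h => (hx.1 h).trans_le hz.1, fun h => hz.2.trans_lt (hy.2 h)⟩⟩

lemma logQ_one (q : ℝ) : logQ q 1 = 0 := by
  simp [logQ]

lemma conjTranspose_coord_mul_diagonal_mul_coord {A : Matrix m m ℂ} {W : Matrix n n ℂ}
    (hA : A.IsHermitian) (hW : W.IsHermitian) (g : ℝ → ℝ) (K : Matrix m n ℂ) :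
    (coord hA hW K)ᴴ * diagonal (fun i => (g (hA.eigenvalues i) : ℂ)) * coord hA hW K =
      (hW.eigenvectorUnitary : Matrix n n ℂ)ᴴ * (Kᴴ * cfc g A * K) *
        (hW.eigenvectorUnitary : Matrix n n ℂ) := by
  rw [cfc_eq_conj hA]
  simp only [coord, conjTranspose_mul, conjTranspose_conjTranspose, Matrix.mul_assoc]

lemma sum_norm_sq_coord_mul {A : Matrix m m ℂ} {W : Matrix n n ℂ}
    (hA : A.IsHermitian) (hW : W.IsHermitian) (g : ℝ → ℝ) (K : Matrix m n ℂ) (j : n) :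
    ∑ i, ‖coord hA hW K i j‖ ^ 2 * g (hA.eigenvalues i) =
      (((hW.eigenvectorUnitary : Matrix n n ℂ)ᴴ * (Kᴴ * cfc g A * K) *
        (hW.eigenvectorUnitary : Matrix n n ℂ)) j j).re := by
  rw [← conjTranspose_coord_mul_diagonal_mul_coord hA hW, Matrix.mul_apply, Complex.re_sum]
  refine Finset.sum_congr rfl fun i _ => ?_
  rw [mul_diagonal, conjTranspose_apply, mul_right_comm, Complex.re_mul_ofReal,
    ← starRingEnd_apply, mul_comm (starRingEnd ℂ _), Complex.mul_conj, Complex.ofReal_re,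
    Complex.normSq_eq_norm_sq]

/-- Each eigenvalue of the compression is a combination of the numbers `log_q (a i)` with weights of
sum at most `1`. The columns of `D` supply the missing weight, placed at `log_q 1 = 0`, so the
eigenvalue is a convex combination of points of an interval. -/
lemma spectrum_compressedLogQ_subset {H : Matrix m n ℂ} {D : Matrix n n ℂ}
    (hD : Hᴴ * H + Dᴴ * D = 1) (q : ℝ) {A : Matrix m m ℂ} (hA : A.PosDef) :
    spectrum ℝ (compressedLogQ q H A) ⊆ expQDomain q := by
  have hX := isHermitian_compressedLogQ q H A
  rw [hX.spectrum_real_eq_range_eigenvalues]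
  rintro _ ⟨j, rfl⟩
  have h1 : hX.eigenvalues j =
      ∑ i, ‖coord hA.1 hX H i j‖ ^ 2 * logQ q (hA.1.eigenvalues i) := by
    rw [sum_norm_sq_coord_mul, ← compressedLogQ]
    have h : (hX.eigenvectorUnitary : Matrix n n ℂ)ᴴ * compressedLogQ q H A *
        (hX.eigenvectorUnitary : Matrix n n ℂ) =
          diagonal (fun j => (hX.eigenvalues j : ℂ)) := by
      have := cfc_eq_conj hX (fun x => x)
      rw [cfc_id' ℝ _ hX.isSelfAdjoint] at this
      refine (congrArg (fun M => _ * M * _) this).trans ?_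
      simp only [Matrix.mul_assoc, conjTranspose_mul_self_eigenvectorUnitary hX, Matrix.mul_one]
      rw [← Matrix.mul_assoc, conjTranspose_mul_self_eigenvectorUnitary hX, Matrix.one_mul]
    rw [h, diagonal_apply_eq, Complex.ofReal_re]
  have h2 : ∑ i, ‖coord hA.1 hX H i j‖ ^ 2 + ∑ i, ‖coord (isHermitian_one) hX D i j‖ ^ 2 = 1 := by
    have e1 := sum_norm_sq_coord_mul hA.1 hX (fun _ => 1) H j
    have e2 := sum_norm_sq_coord_mul isHermitian_one hX (fun _ => 1) D j
    rw [cfc_const_one ℝ _ hA.1.isSelfAdjoint] at e1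
    rw [cfc_const_one ℝ _ (.one _)] at e2
    simp only [mul_one, Matrix.mul_one] at e1 e2
    rw [e1, e2, ← Complex.add_re, ← Matrix.add_apply, ← Matrix.add_mul, ← Matrix.mul_add, hD,
      Matrix.mul_one, conjTranspose_mul_self_eigenvectorUnitary hX]
    simp
  have h3 := (convex_expQDomain q).sum_mem (t := (Finset.univ : Finset (m ⊕ n)))
    (w := Sum.elim (fun i => ‖coord hA.1 hX H i j‖ ^ 2)
      (fun i => ‖coord (isHermitian_one) hX D i j‖ ^ 2))
    (z := Sum.elim (fun i => logQ q (hA.1.eigenvalues i)) (fun _ => logQ q 1))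
    (by rintro (i | i) _ <;> exact sq_nonneg _) (by simpa [Fintype.sum_sum_type] using h2)
    (by
      rintro (i | i) _
      · exact logQ_mem_expQDomain (hA.eigenvalues_pos i)
      · exact logQ_mem_expQDomain one_pos)
  simp only [Fintype.sum_sum_type, Sum.elim_inl, Sum.elim_inr, logQ_one, smul_eq_mul,
    mul_zero, Finset.sum_const_zero, add_zero] at h3
  rwa [h1]

lemma spectralSum_relLogQ (q : ℝ) (K : Matrix m n ℂ) {A : Matrix m m ℂ} {W : Matrix n n ℂ}
    (hA : A.IsHermitian) (hW : W.IsHermitian) :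
    spectralSum (relLogQ q) K A W =
      (Kᴴ * cfc (logQ q) A * K * cfc (fun w : ℝ => w ^ (2 - q)) W).trace.re -
        (Kᴴ * K * cfc (fun w : ℝ => w ^ (2 - q) * logQ q w) W).trace.re := by
  rw [← spectralSum_mul _ _ K hA hW, ← spectralSum_right _ K hA hW, ← spectralSum_sub]
  congr 1
  ext a w
  rw [relLogQ]
  ring

/-! ### The variational principle -/

/-- The variational functional whose optimum over `W` is `traceExpQ q H A`. -/
noncomputable def tangentTrace (q : ℝ) (H : Matrix m n ℂ) (D : Matrix n n ℂ)
    (P : Matrix m m ℂ × Matrix n n ℂ) : ℝ :=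
  P.2.trace.re + spectralSum (relLogQ q) H P.1 P.2 + spectralSum (relLogQ q) D 1 P.2

lemma tangentTrace_eq {H : Matrix m n ℂ} {D : Matrix n n ℂ}
    (hD : Hᴴ * H + Dᴴ * D = 1) (q : ℝ) {A : Matrix m m ℂ} {W : Matrix n n ℂ}
    (hA : A.IsHermitian) (hW : W.IsHermitian) :
    tangentTrace q H D (A, W) = W.trace.re +
      ((compressedLogQ q H A * cfc (fun w : ℝ => w ^ (2 - q)) W).trace.re -
        (cfc (fun w : ℝ => w ^ (2 - q) * logQ q w) W).trace.re) := by
  have h1 : cfc (logQ q) (1 : Matrix n n ℂ) = 0 := by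
    have := cfc_algebraMap (A := Matrix n n ℂ) (1 : ℝ) (logQ q)
    rwa [map_one, logQ_one, map_zero] at this
  have h2 : (cfc (fun w : ℝ => w ^ (2 - q) * logQ q w) W).trace.re =
      (Hᴴ * H * cfc (fun w : ℝ => w ^ (2 - q) * logQ q w) W).trace.re +
        (Dᴴ * D * cfc (fun w : ℝ => w ^ (2 - q) * logQ q w) W).trace.re := by
    rw [← Complex.add_re, ← trace_add, ← Matrix.add_mul, hD, Matrix.one_mul]
  rw [tangentTrace, spectralSum_relLogQ q H hA hW,
    spectralSum_relLogQ q D isHermitian_one hW, h1, h2, compressedLogQ]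
  simp only [Matrix.mul_zero, Matrix.zero_mul, trace_zero, Complex.zero_re]
  ring

/-- Klein's inequality for the tangents of `exp_q`, as an exact formula. -/
lemma traceExpQ_sub_tangentTrace {H : Matrix m n ℂ} {D : Matrix n n ℂ}
    (hD : Hᴴ * H + Dᴴ * D = 1) (q : ℝ) {A : Matrix m m ℂ} {W : Matrix n n ℂ}
    (hA : A.IsHermitian) (hW : W.IsHermitian) :
    traceExpQ q H A - tangentTrace q H D (A, W) =
      spectralSum (fun x w : ℝ => expQ q x - (w + w ^ (2 - q) * (x - logQ q w))) 1
        (compressedLogQ q H A) W := by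
  have hX := isHermitian_compressedLogQ q H A
  have e1 := spectralSum_left (expQ q) 1 hX hW
  have e2 := spectralSum_right (fun w => w) 1 hX hW
  have e3 := spectralSum_mul (fun x => x) (fun w => w ^ (2 - q)) 1 hX hW
  have e4 := spectralSum_right (fun w => w ^ (2 - q) * logQ q w) 1 hX hW
  rw [cfc_id' ℝ W hW.isSelfAdjoint] at e2
  rw [cfc_id' ℝ _ hX.isSelfAdjoint] at e3
  simp only [conjTranspose_one, Matrix.one_mul, Matrix.mul_one] at e1 e2 e3 e4
  rw [tangentTrace_eq hD q hA hW, traceExpQ, ← e1, ← e2, ← e3, ← e4, ← spectralSum_sub,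
    ← spectralSum_add, ← spectralSum_sub]
  congr 1
  ext x w
  ring

lemma tangentTrace_le_traceExpQ {H : Matrix m n ℂ} {D : Matrix n n ℂ}
    (hD : Hᴴ * H + Dᴴ * D = 1) {q : ℝ} (hq : q ≤ 2) {P : Matrix m m ℂ × Matrix n n ℂ}
    (hP : P ∈ posDefPairs m n) : tangentTrace q H D P ≤ traceExpQ q H P.1 := by
  have hX := isHermitian_compressedLogQ q H P.1
  rw [← sub_nonneg, traceExpQ_sub_tangentTrace hD q hP.1.1 hP.2.1]
  exact spectralSum_nonneg _ hX hP.2.1 fun i j => sub_nonneg.2 <| tangent_expQ_le hq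
    (spectrum_compressedLogQ_subset hD q hP.1 (hX.eigenvalues_mem_spectrum_real i))
    (hP.2.eigenvalues_pos j)

lemma traceExpQ_le_tangentTrace {H : Matrix m n ℂ} {D : Matrix n n ℂ}
    (hD : Hᴴ * H + Dᴴ * D = 1) {q : ℝ} (hq : 2 ≤ q) {P : Matrix m m ℂ × Matrix n n ℂ}
    (hP : P ∈ posDefPairs m n) : traceExpQ q H P.1 ≤ tangentTrace q H D P := by
  have hX := isHermitian_compressedLogQ q H P.1
  have h := traceExpQ_sub_tangentTrace hD q hP.1.1 hP.2.1
  have h2 : 0 ≤ spectralSum (fun x w => (-1) * (expQ q x - (w + w ^ (2 - q) * (x - logQ q w))))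
      1 (compressedLogQ q H P.1) P.2 :=
    spectralSum_nonneg _ hX hP.2.1 fun i j => by
      have := expQ_le_tangent hq
        (spectrum_compressedLogQ_subset hD q hP.1 (hX.eigenvalues_mem_spectrum_real i))
        (hP.2.eigenvalues_pos j)
      linarith
  rw [spectralSum_const_mul, ← h] at h2
  linarith

lemma exists_tangentTrace_eq_traceExpQ {H : Matrix m n ℂ} {D : Matrix n n ℂ}
    (hD : Hᴴ * H + Dᴴ * D = 1) (q : ℝ) {A : Matrix m m ℂ} (hA : A.PosDef) :
    ∃ W : Matrix n n ℂ, W.PosDef ∧ tangentTrace q H D (A, W) = traceExpQ q H A := by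
  have hX := isHermitian_compressedLogQ q H A
  have hs := spectrum_compressedLogQ_subset hD q hA
  have hW : (cfc (expQ q) (compressedLogQ q H A)).IsHermitian :=
    (cfc_predicate (expQ q) (compressedLogQ q H A) : IsSelfAdjoint _)
  have hspec : spectrum ℝ (cfc (expQ q) (compressedLogQ q H A)) =
      expQ q '' spectrum ℝ (compressedLogQ q H A) :=
    cfc_map_spectrum (expQ q) _ hX.isSelfAdjoint (finite_real_spectrum.continuousOn _)
  -- The optimal `W` is `exp_q X` with `X` the compression: then `log_q W = X`, and the correction
  -- to `Tr W` vanishes.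
  refine ⟨_, hW.posDef_iff_eigenvalues_pos.2 fun i => ?_, ?_⟩
  · obtain ⟨x, hx, hxi⟩ := hspec ▸ hW.eigenvalues_mem_spectrum_real i
    rw [← hxi]
    exact expQ_pos (hs hx)
  · have hlog : cfc (logQ q) (cfc (expQ q) (compressedLogQ q H A)) = compressedLogQ q H A := by
      rw [← cfc_comp' (logQ q) (expQ q) _ ((finite_real_spectrum.image _).continuousOn _)
        (finite_real_spectrum.continuousOn _) hX.isSelfAdjoint]
      conv_rhs => rw [← cfc_id' ℝ _ hX.isSelfAdjoint]
      exact cfc_congr fun x hx => logQ_expQ (hs hx)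
    rw [tangentTrace_eq hD q hA.1 hW, cfc_mul (fun w => w ^ (2 - q)) (logQ q) _
      (finite_real_spectrum.continuousOn _) (finite_real_spectrum.continuousOn _), hlog,
      Matrix.trace_mul_comm, sub_self, add_zero, traceExpQ]

/-- The sign `c = ±1` covers the concave and the convex case together. The form at `D` needs only
pairs `(1, W)`, which are stable under convex combinations. -/
lemma tangentTrace_combo_of_jointConvex {q c : ℝ} {H : Matrix m n ℂ} {D : Matrix n n ℂ}
    (hH : JointConvex (fun a w => c * relLogQ q a w) H)
    (hD : JointConvex (fun a w => c * relLogQ q a w) D)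
    {P Q : Matrix m m ℂ × Matrix n n ℂ} (hP : P ∈ posDefPairs m n) (hQ : Q ∈ posDefPairs m n)
    {a b : ℝ} (ha : 0 ≤ a) (hb : 0 ≤ b) (hab : a + b = 1) :
    c * tangentTrace q H D (a • P + b • Q) ≤
      a * (c * tangentTrace q H D P) + b * (c * tangentTrace q H D Q) := by
  have h1 := hH.2 hP hQ ha hb hab
  have h2 := hD.2 (x := (1, P.2)) ⟨PosDef.one, hP.2⟩ (y := (1, Q.2)) ⟨PosDef.one, hQ.2⟩ ha hb hab
  have h3 : a • (1 : Matrix n n ℂ) + b • (1 : Matrix n n ℂ) = 1 := by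
    rw [← add_smul, hab, one_smul]
  simp only [spectralSum_const_mul, Prod.fst_add, Prod.snd_add, Prod.smul_fst, Prod.smul_snd,
    smul_eq_mul, h3] at h1 h2
  simp only [tangentTrace, Prod.fst_add, Prod.snd_add, Prod.smul_fst, Prod.smul_snd, trace_add,
    trace_smul, Complex.add_re, Complex.smul_re, smul_eq_mul]
  linarith

/-! ### Partial optimization over `W` -/

lemma concaveOn_traceExpQ {H : Matrix m n ℂ} (hH : IsContraction H) {q : ℝ} (h0 : 0 ≤ q)
    (h2 : q ≤ 2) : ConcaveOn ℝ {A : Matrix m m ℂ | A.PosDef} (traceExpQ q H) := by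
  obtain ⟨D, hD⟩ := exists_conjTranspose_mul_self_add_eq_one hH
  refine ⟨convex_posDef, fun A hA B hB a b ha hb hab => ?_⟩
  obtain ⟨V, hV, hAV⟩ := exists_tangentTrace_eq_traceExpQ hD q hA
  obtain ⟨W, hW, hBW⟩ := exists_tangentTrace_eq_traceExpQ hD q hB
  have hP : (A, V) ∈ posDefPairs m n := ⟨hA, hV⟩
  have hQ : (B, W) ∈ posDefPairs m n := ⟨hB, hW⟩
  have h := tangentTrace_combo_of_jointConvex (c := -1) (q := q) (H := H) (D := D)
    (by simpa using jointConvex_neg_relLogQ h0 h2 H)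
    (by simpa using jointConvex_neg_relLogQ h0 h2 D) hP hQ ha hb hab
  -- The combination of the two optimizers need not be optimal for `a • A + b • B`; it only has to
  -- give a lower bound there.
  have h' := tangentTrace_le_traceExpQ hD h2 (convex_posDefPairs hP hQ ha hb hab)
  rw [hAV, hBW] at h
  change a * traceExpQ q H A + b * traceExpQ q H B ≤ traceExpQ q H (a • A + b • B)
  refine le_trans ?_ h'
  linarith

lemma convexOn_traceExpQ {H : Matrix m n ℂ} (hH : IsContraction H) {q : ℝ} (h2 : 2 < q)
    (h3 : q ≤ 3) : ConvexOn ℝ {A : Matrix m m ℂ | A.PosDef} (traceExpQ q H) := by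
  obtain ⟨D, hD⟩ := exists_conjTranspose_mul_self_add_eq_one hH
  refine ⟨convex_posDef, fun A hA B hB a b ha hb hab => ?_⟩
  obtain ⟨V, hV, hAV⟩ := exists_tangentTrace_eq_traceExpQ hD q hA
  obtain ⟨W, hW, hBW⟩ := exists_tangentTrace_eq_traceExpQ hD q hB
  have hP : (A, V) ∈ posDefPairs m n := ⟨hA, hV⟩
  have hQ : (B, W) ∈ posDefPairs m n := ⟨hB, hW⟩
  have h := tangentTrace_combo_of_jointConvex (c := 1) (q := q) (H := H) (D := D)
    (by simpa using jointConvex_relLogQ h2 h3 H)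
    (by simpa using jointConvex_relLogQ h2 h3 D) hP hQ ha hb hab
  have h' := traceExpQ_le_tangentTrace hD h2.le (convex_posDefPairs hP hQ ha hb hab)
  rw [hAV, hBW] at h
  change traceExpQ q H (a • A + b • B) ≤ a * traceExpQ q H A + b * traceExpQ q H B
  refine h'.trans ?_
  linarith

end SpectralSum

/-- The first clause says that `φ` is well defined on positive definite matrices. -/
theorem corollary2p3 {m n : Type*} [Fintype m] [DecidableEq m] [Fintype n] [DecidableEq n]
    (H : Matrix m n ℂ) (hH : IsContraction H) (q : ℝ) :
    (0 ≤ q → q ≤ 3 → ∀ A : Matrix m m ℂ, A.PosDef →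
      (compressedLogQ q H A).IsHermitian ∧
        spectrum ℝ (compressedLogQ q H A) ⊆ expQDomain q) ∧
    (0 ≤ q → q < 1 → ConcaveOn ℝ {A : Matrix m m ℂ | A.PosDef} (traceExpQ q H)) ∧
    (1 ≤ q → q ≤ 2 → ConcaveOn ℝ {A : Matrix m m ℂ | A.PosDef} (traceExpQ q H)) ∧
    (2 < q → q ≤ 3 → ConvexOn ℝ {A : Matrix m m ℂ | A.PosDef} (traceExpQ q H)) := by
  obtain ⟨D, hD⟩ := SpectralSum.exists_conjTranspose_mul_self_add_eq_one hH
  exact ⟨fun _ _ A hA => ⟨SpectralSum.isHermitian_compressedLogQ q H A,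
      SpectralSum.spectrum_compressedLogQ_subset hD q hA⟩,
    fun h0 h1 => SpectralSum.concaveOn_traceExpQ hH h0 (by linarith),
    fun h1 h2 => SpectralSum.concaveOn_traceExpQ hH (by linarith) h2,
    fun h2 h3 => SpectralSum.convexOn_traceExpQ hH h2 h3⟩
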